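/- Let $H$ be an infinite-dimensional separable complex Hilbert space and let $\mathcal T=(T_1,\dots,T_n)$ be an $n$-tuple of bounded linear operators on $H$. Define the following subsets of $\mathbb C^n$: - the joint numerical range $W(\mathcal T)=\{(\langle T_1x,x\rangle,\dots,\langle T_nx,x\rangle): x\in H,\ \|x\|=1\}$; - the joint essential numerical range $W_e(\mathcal T)$, the set of all $(\lambda_1,\dots,\lambda_n)\in\mathbb C^n$ for which there is an orthonormal sequence $(u_j)_{j=1}^\infty$ in $H$ with $\lim_{j\to\infty}\langle T_ku_j,u_j\rangle=\lambda_k$ for all $k=1,\dots,n$; - the set of constant diagonals $\mathcal D_{\rm const}(\mathcal T)$, the set of all $(\lambda_1,\dots,\lambda_n)\in\mathbb C^n$ for which there is an orthonormal basis $(u_j)_{j=1}^\infty$ of $H$ with $\langle T_ku_j,u_j\rangle=\lambda_k$ for all $j\ge 1$ and $k=1,\dots,n$. Identify $\mathbb C^n$ with $\mathbb R^{2n}$. For $A\subset\mathbb C^n$, let $\operatorname{Relint}A$ be the interior of $A$ relative to the smallest real affine subspace containing $A$, and call a nonempty set $A$ relatively open if it is open in that subspace. Then the following conditions are equivalent: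 (i) $\mathcal D_{\rm const}(\mathcal T)=W(\mathcal T)$; (ii) $W(\mathcal T)=\operatorname{Relint}W_e(\mathcal T)$; (iii) $W(\mathcal T)$ is convex and relatively open. -/

import Mathlib

open Set Filter Topology

/-- The joint numerical range `W(T₁, …, Tₙ)`: all `(⟨T₁x, x⟩, …, ⟨Tₙx, x⟩)` with `‖x‖ = 1`.
Mathlib's inner product is linear in its second argument, so `⟨T x, x⟩` reads `inner ℂ x (T x)`. -/
def jointNumericalRange {H : Type*} [NormedAddCommGroup H] [InnerProductSpace ℂ H] {n : ℕ}
    (T : Fin n → H →L[ℂ] H) : Set (Fin n → ℂ) :=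
  {l | ∃ x : H, ‖x‖ = 1 ∧ ∀ k, inner ℂ x (T k x) = l k}

/-- The joint essential numerical range `W_e(T₁, …, Tₙ)` : all `(l₁, …, lₙ)` for which some
orthonormal sequence `(uⱼ)` satisfies `⟨T_k uⱼ, uⱼ⟩ → l_k` as `j → ∞`, for every `k`. -/
def jointEssentialNumericalRange {H : Type*} [NormedAddCommGroup H] [InnerProductSpace ℂ H]
    {n : ℕ} (T : Fin n → H →L[ℂ] H) : Set (Fin n → ℂ) :=
  {l | ∃ u : ℕ → H, Orthonormal ℂ u ∧
    ∀ k, Tendsto (fun j => inner ℂ (u j) (T k (u j))) atTop (𝓝 (l k))}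

/-- The set of constant diagonals of a tuple of operators on a separable infinite-dimensional
Hilbert space: all `(l₁, …, lₙ)` for which some orthonormal basis `(uⱼ)` of `H` satisfies
`⟨T_k uⱼ, uⱼ⟩ = l_k` for all `j` and `k`. Orthonormal bases of such a space are sequences. -/
def constantDiagonals {H : Type*} [NormedAddCommGroup H] [InnerProductSpace ℂ H]
    {n : ℕ} (T : Fin n → H →L[ℂ] H) : Set (Fin n → ℂ) :=
  {l | ∃ u : HilbertBasis ℕ ℂ H, ∀ j k, inner ℂ (u j) (T k (u j)) = l k}

/-- A subset of `ℂⁿ`, seen as a real vector space, is relatively open if it is non-empty and open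
in the smallest real affine subspace that contains it. -/
def IsRelativelyOpen {n : ℕ} (A : Set (Fin n → ℂ)) : Prop :=
  A.Nonempty ∧ IsOpen ((↑) ⁻¹' A : Set (affineSpan ℝ A))

/-! ### Relative interiors of convex sets. -/

section ConvexGeometry

variable {E : Type*} [NormedAddCommGroup E] [NormedSpace ℝ E]

/-! Everything rests on one orthogonality trick: if `y` is orthogonal to `x`, to all `T k x` and to
all `(T k).adjoint x`, the quadratic forms add on `x + y`. These are finitely many conditions, and
`W_e` is described by approximation on every subspace of finite codimension, so approximating
vectors can always be chosen this independently. Hence `W_e` is convex.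

If `W` lies in the affine span of `W_e`, a relative interior point `w` of `W_e` is attained exactly
in every `Fᗮ` (`exists_mem_orthogonal_jointForm_eq`). An orthonormal basis with constant diagonal
`w` is then built greedily. A unit vector `e` along the residual of a target is mixed with an
independent `x` whose value compensates that of `e`; each such step shrinks the squared distance to
the target by a fixed factor (`exists_infDist_sup_span_singleton_le`).

The converse inclusions use supporting functionals `f`. If `f ≤ M` on `W`, the form `M ‖x‖² - f
(jointForm T x)` is nonnegative. If it vanishes on an orthonormal basis it vanishes everywhere, so a
constant diagonal cannot lie on the relative boundary of `W_e` when `W` consists of such diagonals.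
If it is not bounded away from zero on the unit sphere, it vanishes at a unit vector or tends to
zero along an orthonormal sequence, so `sup f` over `W` is reached on `W` or on `W_e`. For
relatively open `W` this forces `W ⊆ W_e`, whence `W_e = closure W`. -/

theorem mem_intrinsicInterior_iff_dist_lt {C : Set E} {x : E} :
    x ∈ intrinsicInterior ℝ C ↔ x ∈ affineSpan ℝ C ∧
      ∃ r > 0, ∀ y ∈ affineSpan ℝ C, dist y x < r → y ∈ C := by
  rw [mem_intrinsicInterior]
  constructor
  · rintro ⟨y, hy, rfl⟩
    refine ⟨y.2, ?_⟩
    obtain ⟨r, hr, h⟩ := Metric.mem_nhds_iff.1 (mem_interior_iff_mem_nhds.1 hy)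
    exact ⟨r, hr, fun z hz hd => h (show (⟨z, hz⟩ : affineSpan ℝ C) ∈ Metric.ball y r from hd)⟩
  · rintro ⟨hx, r, hr, h⟩
    refine ⟨⟨x, hx⟩, mem_interior_iff_mem_nhds.2 (Metric.mem_nhds_iff.2 ⟨r, hr, ?_⟩), rfl⟩
    exact fun z hz => h z.1 z.2 hz

theorem isOpen_preimage_affineSpan_iff {C : Set E} :
    IsOpen ((↑) ⁻¹' C : Set (affineSpan ℝ C)) ↔ C ⊆ intrinsicInterior ℝ C := by
  rw [← interior_eq_iff_isOpen]
  constructor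
  · intro h x hx
    refine mem_intrinsicInterior.2 ⟨⟨x, subset_affineSpan ℝ C hx⟩, ?_, rfl⟩
    rw [h]
    exact hx
  · intro h
    refine interior_subset.antisymm fun x hx => ?_
    obtain ⟨y, hy, hyx⟩ := mem_intrinsicInterior.1 (h hx)
    rwa [← Subtype.ext hyx]

theorem intrinsicInterior_subset_intrinsicInterior_of_affineSpan_eq {C D : Set E} (h : C ⊆ D)
    (hs : affineSpan ℝ D ≤ affineSpan ℝ C) : intrinsicInterior ℝ C ⊆ intrinsicInterior ℝ D := by
  intro x hx
  obtain ⟨hx, r, hr, hb⟩ := mem_intrinsicInterior_iff_dist_lt.1 hx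
  exact mem_intrinsicInterior_iff_dist_lt.2
    ⟨affineSpan_mono ℝ h hx, r, hr, fun y hy hd => h (hb y (hs hy) hd)⟩

theorem exists_forall_dist_lt_mem_intrinsicInterior {C : Set E} {x : E}
    (hx : x ∈ intrinsicInterior ℝ C) :
    ∃ r > 0, ∀ y ∈ affineSpan ℝ C, dist y x < r → y ∈ intrinsicInterior ℝ C := by
  obtain ⟨hxC, r, hr, hb⟩ := mem_intrinsicInterior_iff_dist_lt.1 hx
  refine ⟨r, hr, fun y hy hd => ?_⟩
  refine mem_intrinsicInterior_iff_dist_lt.2 ⟨hy, r - dist y x, by linarith, fun z hz hd' => ?_⟩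
  exact hb z hz (by linarith [dist_triangle z y x])

theorem intrinsicInterior_subset_intrinsicInterior_self (C : Set E) :
    intrinsicInterior ℝ C ⊆ intrinsicInterior ℝ (intrinsicInterior ℝ C) := by
  intro x hx
  obtain ⟨r, hr, hb⟩ := exists_forall_dist_lt_mem_intrinsicInterior hx
  exact mem_intrinsicInterior_iff_dist_lt.2 ⟨subset_affineSpan ℝ _ hx, r, hr,
    fun y hy hd => hb y (affineSpan_mono ℝ intrinsicInterior_subset hy) hd⟩

/-- Prolonging a segment slightly past `x` shows that a linear functional which is maximal over `C`
at `x` is constant on `C`. -/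
theorem exists_pos_lineMap_neg_mem {C : Set E} {x z : E} (hx : x ∈ intrinsicInterior ℝ C)
    (hz : z ∈ affineSpan ℝ C) : ∃ t > 0, AffineMap.lineMap x z (-t : ℝ) ∈ C := by
  obtain ⟨hxC, r, hr, hb⟩ := mem_intrinsicInterior_iff_dist_lt.1 hx
  refine ⟨r / (dist x z + 1), by positivity, hb _ (AffineMap.lineMap_mem _ hxC hz) ?_⟩
  have h0 : 0 ≤ dist x z := dist_nonneg
  rw [dist_lineMap_left, norm_neg, Real.norm_of_nonneg (by positivity), div_mul_eq_mul_div,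
    div_lt_iff₀ (by positivity)]
  nlinarith

theorem Convex.lineMap_mem_intrinsicInterior {C : Set E} (hC : Convex ℝ C) {c z : E}
    (hc : c ∈ intrinsicInterior ℝ C) (hz : z ∈ C) {t : ℝ} (ht0 : 0 ≤ t) (ht1 : t < 1) :
    AffineMap.lineMap c z t ∈ intrinsicInterior ℝ C := by
  obtain ⟨hcC, r, hr, hb⟩ := mem_intrinsicInterior_iff_dist_lt.1 hc
  have hz' := subset_affineSpan ℝ C hz
  have hm : AffineMap.lineMap c z t ∈ affineSpan ℝ C := AffineMap.lineMap_mem t hcC hz'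
  have h1 : (0 : ℝ) < 1 - t := by linarith
  refine mem_intrinsicInterior_iff_dist_lt.2 ⟨hm, (1 - t) * r, by positivity, fun y hy hd => ?_⟩
  set p := AffineMap.lineMap c z t with hp
  -- The homothety with centre `z` and ratio `1 - t` maps `c` to `p`; this point is the preimage of
  -- `y`, and it falls in the ball about `c`.
  have hc' : c + (1 - t)⁻¹ • (y - p) ∈ affineSpan ℝ C := by
    have := AffineSubspace.vadd_mem_of_mem_direction
      ((affineSpan ℝ C).direction.smul_mem (1 - t)⁻¹ (AffineSubspace.vsub_mem_direction hy hm)) hcC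
    rwa [vadd_eq_add, add_comm] at this
  have hcC' := hb _ hc' (by
    rw [dist_eq_norm, add_sub_cancel_left, norm_smul, norm_inv, Real.norm_of_nonneg h1.le,
      ← dist_eq_norm, inv_mul_lt_iff₀ h1]
    exact hd)
  have := hC hcC' hz h1.le ht0 (by ring)
  convert this using 1
  rw [smul_add, smul_smul, mul_inv_cancel₀ h1.ne', one_smul, hp, AffineMap.lineMap_apply_module]
  abel

theorem Convex.convex_intrinsicInterior {C : Set E} (hC : Convex ℝ C) :
    Convex ℝ (intrinsicInterior ℝ C) := by
  intro x hx y hy a b ha hb hab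
  rcases eq_or_lt_of_le ha with rfl | ha
  · have : b = 1 := by linarith
    simpa [this] using hy
  · have := hC.lineMap_mem_intrinsicInterior hx (intrinsicInterior_subset hy) hb (by linarith)
    rw [AffineMap.lineMap_apply_module] at this
    rwa [show a = 1 - b by linarith]

theorem Convex.subset_closure_intrinsicInterior [FiniteDimensional ℝ E] {C : Set E}
    (hC : Convex ℝ C) : C ⊆ closure (intrinsicInterior ℝ C) := by
  intro z hz
  obtain ⟨c, hc⟩ := Set.Nonempty.intrinsicInterior hC ⟨z, hz⟩
  have h : Tendsto (fun t : ℝ => AffineMap.lineMap c z t) (𝓝[<] 1) (𝓝 z) := by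
    have : Continuous (fun t : ℝ => AffineMap.lineMap (k := ℝ) c z t) :=
      AffineMap.lineMap_continuous
    have h1 := this.tendsto 1
    rw [AffineMap.lineMap_apply_one] at h1
    exact h1.mono_left nhdsWithin_le_nhds
  refine mem_closure_of_tendsto h ?_
  filter_upwards [Ioo_mem_nhdsLT (show (0 : ℝ) < 1 by norm_num)] with t ht
  exact hC.lineMap_mem_intrinsicInterior hc hz ht.1.le ht.2

/-- Translated into the direction of its affine span, `C` becomes open, so Hahn–Banach separates
strictly on all of `C`; the functional is then extended to `E`. -/
theorem Convex.exists_lt_of_notMem_of_subset_intrinsicInterior {C : Set E} (hC : Convex ℝ C)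
    (hne : C.Nonempty) (hopen : C ⊆ intrinsicInterior ℝ C) {x : E} (hx : x ∈ affineSpan ℝ C)
    (hxC : x ∉ C) : ∃ f : E →L[ℝ] ℝ, ∀ w ∈ C, f w < f x := by
  obtain ⟨c, hc⟩ := hne
  have hcs := subset_affineSpan ℝ C hc
  let V := (affineSpan ℝ C).direction
  let U : Set V := {v | (v : E) + c ∈ C}
  have hUc : Convex ℝ U := by
    intro u hu v hv a b ha hb hab
    have := hC hu hv ha hb hab
    change ((a • u + b • v : V) : E) + c ∈ C
    convert this using 1
    rw [smul_add, smul_add, add_add_add_comm, ← add_smul, hab, one_smul]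
    rfl
  have hUo : IsOpen U := by
    rw [Metric.isOpen_iff]
    intro u hu
    obtain ⟨-, r, hr, hb⟩ := mem_intrinsicInterior_iff_dist_lt.1 (hopen hu)
    refine ⟨r, hr, fun v hv => hb _ ?_ ?_⟩
    · exact AffineSubspace.vadd_mem_of_mem_direction v.2 hcs
    · rw [dist_add_right]; exact hv
  let x' : V := ⟨x - c, AffineSubspace.vsub_mem_direction hx hcs⟩
  have hx' : x' ∉ U := fun h => hxC (by simpa [U, x'] using h)
  obtain ⟨f, hf⟩ := geometric_hahn_banach_open_point hUc hUo hx'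
  obtain ⟨g, hg, -⟩ := exists_extension_norm_eq V f
  refine ⟨g, fun w hw => ?_⟩
  have h := hf ⟨w - c, AffineSubspace.vsub_mem_direction (subset_affineSpan ℝ C hw) hcs⟩
    (by simpa [U] using hw)
  rw [← hg, ← hg] at h
  simpa [x'] using h

theorem closure_subset_affineSpan [FiniteDimensional ℝ E] (C : Set E) :
    closure C ⊆ affineSpan ℝ C :=
  closure_minimal (subset_affineSpan ℝ C) (AffineSubspace.closed_of_finiteDimensional _)

/-- A functional separating an extra point `x` strictly from `C` stays at most `f x` on the closure,
but exceeds `f x` just past `x` on a segment coming from `C`. -/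
theorem Convex.intrinsicInterior_closure_eq_self [FiniteDimensional ℝ E] {C : Set E}
    (hC : Convex ℝ C) (hne : C.Nonempty) (hopen : C ⊆ intrinsicInterior ℝ C) :
    intrinsicInterior ℝ (closure C) = C := by
  have hspan : affineSpan ℝ (closure C) ≤ affineSpan ℝ C :=
    affineSpan_le.2 (closure_subset_affineSpan C)
  refine Subset.antisymm (fun x hx => ?_) (hopen.trans
    (intrinsicInterior_subset_intrinsicInterior_of_affineSpan_eq subset_closure hspan))
  by_contra hxC
  obtain ⟨f, hf⟩ := hC.exists_lt_of_notMem_of_subset_intrinsicInterior hne hopen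
    (closure_subset_affineSpan C (intrinsicInterior_subset hx)) hxC
  obtain ⟨c, hc⟩ := hne
  obtain ⟨t, ht, hm⟩ := exists_pos_lineMap_neg_mem hx
    (subset_affineSpan ℝ _ (subset_closure hc))
  have h1 : f (AffineMap.lineMap x c (-t)) ≤ f x :=
    closure_minimal (fun w hw => (hf w hw).le) (isClosed_le f.continuous continuous_const) hm
  rw [AffineMap.lineMap_apply_module] at h1
  simp only [map_add, map_smul, smul_eq_mul] at h1
  nlinarith [hf c hc]

/-- A point of the relative interior of `C` is a convex combination of finitely many points of `C`,
and stays so when these points are moved a little inside the affine span. -/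
theorem exists_forall_perturbation_exists_stdSimplex [FiniteDimensional ℝ E] {C : Set E} {w : E}
    (hw : w ∈ intrinsicInterior ℝ C) :
    ∃ ε > 0, ∃ (m : ℕ) (d : Fin m → E), (∀ i, d i ∈ C) ∧
      ∀ g : Fin m → E, (∀ i, g i ∈ affineSpan ℝ C) → (∀ i, dist (g i) (d i) < ε) →
        ∃ t ∈ stdSimplex ℝ (Fin m), ∑ i, t i • g i = w := by
  obtain ⟨hwC, r, hr, hb⟩ := mem_intrinsicInterior_iff_dist_lt.1 hw
  set ρ := r / 2 with hρr
  have hρ : 0 < ρ := by positivity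
  have hcomp : IsCompact (Metric.closedBall w ρ ∩ (affineSpan ℝ C : Set E)) :=
    (isCompact_closedBall w ρ).inter_right (AffineSubspace.closed_of_finiteDimensional _)
  obtain ⟨s, hs, hfin, hcov⟩ := hcomp.finite_cover_balls (show 0 < ρ / 4 by positivity)
  have := hfin.fintype
  let e := Fintype.equivFin s
  refine ⟨ρ / 4, by positivity, Fintype.card s, fun i => (e.symm i : E), fun i => ?_, ?_⟩
  · have := hs (e.symm i).2
    refine hb _ this.2 (lt_of_le_of_lt (Metric.mem_closedBall.1 this.1) (by linarith))
  intro g hg hgd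
  -- The `d i` form a `ρ / 4`-net of the closed `ρ`-ball about `w` in the affine span, so the moved
  -- points still form a `ρ / 2`-net.
  have happrox : ∀ y ∈ affineSpan ℝ C, dist y w ≤ ρ → ∃ i, dist (g i) y < ρ / 2 := by
    intro y hy hyw
    obtain ⟨z, hz, hyz⟩ := mem_iUnion₂.1 (hcov ⟨Metric.mem_closedBall.2 hyw, hy⟩)
    refine ⟨e ⟨z, hz⟩, ?_⟩
    have h1 := hgd (e ⟨z, hz⟩)
    simp only [Equiv.symm_apply_apply] at h1
    rw [Metric.mem_ball, dist_comm] at hyz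
    linarith [dist_triangle (g (e ⟨z, hz⟩)) z y]
  let Φ : (Fin (Fintype.card s) → ℝ) →ₗ[ℝ] E := Fintype.linearCombination ℝ g
  have hΦ : ∀ t, Φ t = ∑ i, t i • g i := fun t => Fintype.linearCombination_apply ℝ g t
  have hK1 : Convex ℝ (Φ '' stdSimplex ℝ _) := (convex_stdSimplex ℝ _).linear_image Φ
  have hK2 : IsClosed (Φ '' stdSimplex ℝ _) :=
    ((isCompact_stdSimplex ℝ _).image Φ.continuous_of_finiteDimensional).isClosed
  by_contra hcon
  have hwK : w ∉ Φ '' stdSimplex ℝ _ := by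
    rintro ⟨t, ht, h⟩
    exact hcon ⟨t, ht, by rw [← hΦ, h]⟩
  obtain ⟨f, u, hfw, hfu⟩ := geometric_hahn_banach_point_closed hK1 hK2 hwK
  have hfg : ∀ i, f w < f (g i) := fun i => hfw.trans (hfu _ ⟨Pi.single i 1,
    single_mem_stdSimplex ℝ i, by simp [Φ]⟩)
  let V := (affineSpan ℝ C).direction
  let fV : V →L[ℝ] ℝ := f.comp V.subtypeL
  have hgV : ∀ i, ∀ v : V, dist (g i) (w + v) < ρ / 2 → f (g i - w) - fV v ≤ ‖fV‖ * (ρ / 2) := by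
    intro i v hd
    let z : V := ⟨g i - w, AffineSubspace.vsub_mem_direction (hg i) hwC⟩
    have h1 : f (g i - w) - fV v = fV (z - v) := by simp [fV, z]
    have h2 : ‖z - v‖ ≤ ρ / 2 := by
      rw [dist_eq_norm] at hd
      have : ‖z - v‖ = ‖g i - (w + v)‖ := by
        change ‖((z - v : V) : E)‖ = _
        simp [z, sub_sub]
      linarith
    rw [h1]
    have h3 := fV.le_opNorm (z - v)
    have h4 := mul_le_mul_of_nonneg_left h2 (norm_nonneg fV)
    rw [Real.norm_eq_abs] at h3
    linarith [le_abs_self (fV (z - v))]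
  -- Every `g i` lies strictly above `w` for `f`, yet some `g i` is `ρ / 2`-close to `w + v`. A
  -- vector `v` of length at most `ρ` that nearly norms `fV` contradicts this bound.
  have key : ∀ v : V, ‖v‖ ≤ ρ → -fV v < ‖fV‖ * (ρ / 2) := by
    intro v hv
    obtain ⟨i, hi⟩ := happrox (w + v) (by
      have := AffineSubspace.vadd_mem_of_mem_direction v.2 hwC
      rwa [vadd_eq_add, add_comm] at this) (by rw [dist_eq_norm, add_sub_cancel_left]; exact hv)
    have h1 := hgV i v hi
    have h2 := hfg i
    rw [map_sub] at h1
    linarith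
  have hpos : 0 < ‖fV‖ := by
    have := key 0 (by simpa using hρ.le)
    simp only [map_zero, neg_zero] at this
    exact pos_of_mul_pos_left this (by positivity)
  obtain ⟨v, hv1, hv2⟩ := fV.exists_lt_apply_of_lt_opNorm (show ‖fV‖ / 2 < ‖fV‖ by linarith)
  have hρv : ‖ρ • v‖ ≤ ρ := by
    rw [norm_smul, Real.norm_of_nonneg hρ.le]
    nlinarith
  have k1 := key (ρ • v) hρv
  have k2 := key (-(ρ • v)) (by rwa [norm_neg])
  rw [map_neg] at k2
  rw [map_smul, smul_eq_mul] at k1 k2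
  rw [Real.norm_eq_abs] at hv2
  have := mul_lt_mul_of_pos_left hv2 hρ
  rcases abs_cases (fV v) with ⟨h, -⟩ | ⟨h, -⟩ <;> rw [h] at this <;> linarith

end ConvexGeometry

/-! ### The tuple of quadratic forms and its additivity on independent vectors. -/

section JointForm

variable {H : Type*} [NormedAddCommGroup H] [InnerProductSpace ℂ H] {n : ℕ}
  (T : Fin n → H →L[ℂ] H)

/-- The tuple of quadratic forms `x ↦ (⟨T₁x, x⟩, …, ⟨Tₙx, x⟩)`. -/
noncomputable def jointForm (x : H) : Fin n → ℂ := fun k => inner ℂ x (T k x)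

theorem mem_jointNumericalRange_iff {l : Fin n → ℂ} :
    l ∈ jointNumericalRange T ↔ ∃ x : H, ‖x‖ = 1 ∧ jointForm T x = l := by
  simp only [jointNumericalRange, jointForm, mem_ofPred_eq, funext_iff]

theorem jointForm_mem_jointNumericalRange {x : H} (hx : ‖x‖ = 1) :
    jointForm T x ∈ jointNumericalRange T :=
  (mem_jointNumericalRange_iff T).2 ⟨x, hx, rfl⟩

theorem mem_constantDiagonals_iff {l : Fin n → ℂ} :
    l ∈ constantDiagonals T ↔ ∃ u : HilbertBasis ℕ ℂ H, ∀ j, jointForm T (u j) = l := by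
  simp only [constantDiagonals, jointForm, mem_ofPred_eq, funext_iff]

theorem mem_jointEssentialNumericalRange_iff {l : Fin n → ℂ} :
    l ∈ jointEssentialNumericalRange T ↔
      ∃ u : ℕ → H, Orthonormal ℂ u ∧ Tendsto (fun j => jointForm T (u j)) atTop (𝓝 l) := by
  simp only [jointEssentialNumericalRange, jointForm, mem_ofPred_eq, tendsto_pi_nhds]

theorem continuous_jointForm : Continuous (jointForm T) :=
  continuous_pi fun k => continuous_id.inner (T k).continuous

theorem jointForm_smul (c : ℂ) (x : H) : jointForm T (c • x) = (‖c‖ ^ 2 : ℝ) • jointForm T x := by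
  ext k
  simp only [jointForm, map_smul, inner_smul_left, inner_smul_right, Pi.smul_apply,
    Complex.real_smul, Complex.ofReal_pow, ← Complex.conj_mul']
  ring

theorem jointForm_sqrt_smul {t : ℝ} (ht : 0 ≤ t) (x : H) :
    jointForm T ((√t : ℂ) • x) = t • jointForm T x := by
  rw [jointForm_smul, Complex.norm_real, Real.norm_of_nonneg (Real.sqrt_nonneg t), Real.sq_sqrt ht]

theorem norm_sqrt_smul_sq {t : ℝ} (ht : 0 ≤ t) (x : H) : ‖(√t : ℂ) • x‖ ^ 2 = t * ‖x‖ ^ 2 := by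
  rw [norm_smul, mul_pow, Complex.norm_real, Real.norm_of_nonneg (Real.sqrt_nonneg t),
    Real.sq_sqrt ht]

theorem jointForm_add_add_jointForm_sub (x y : H) :
    jointForm T (x + y) + jointForm T (x - y) = (2 : ℝ) • (jointForm T x + jointForm T y) := by
  ext k
  simp only [jointForm, map_add, map_sub, inner_add_left, inner_sub_left, inner_add_right,
    inner_sub_right, Pi.smul_apply, Pi.add_apply, Complex.real_smul]
  push_cast
  ring

theorem jointForm_normalize (x : H) :
    jointForm T ((‖x‖⁻¹ : ℂ) • x) = (‖x‖ ^ 2)⁻¹ • jointForm T x := by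
  rw [jointForm_smul]
  simp

/-- The span of `x`, `T₁x, …, Tₙx` and `T₁*x, …, Tₙ*x`. -/
def jointSpan [CompleteSpace H] (x : H) : Submodule ℂ H :=
  Submodule.span ℂ ({x} ∪ range (fun k => T k x) ∪ range (fun k => (T k).adjoint x))

instance [CompleteSpace H] (x : H) : FiniteDimensional ℂ (jointSpan T x) :=
  FiniteDimensional.span_of_finite ℂ
    (((finite_singleton x).union (finite_range _)).union (finite_range _))

theorem inner_eq_zero_of_mem_jointSpan_orthogonal [CompleteSpace H] {x y : H}
    (hy : y ∈ (jointSpan T x)ᗮ) : inner ℂ x y = 0 :=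
  (Submodule.mem_orthogonal _ _).1 hy x (Submodule.subset_span (by simp))

/-- Both cross terms vanish: `⟨x, T k y⟩` moves to the adjoint, and `⟨y, T k x⟩` is zero directly.
-/
theorem jointForm_add_of_mem_jointSpan_orthogonal [CompleteSpace H] {x y : H}
    (hy : y ∈ (jointSpan T x)ᗮ) : jointForm T (x + y) = jointForm T x + jointForm T y := by
  ext k
  have h1 : inner ℂ (T k x) y = 0 :=
    (Submodule.mem_orthogonal _ _).1 hy _ (Submodule.subset_span (by simp))
  have h2 : inner ℂ ((T k).adjoint x) y = 0 :=
    (Submodule.mem_orthogonal _ _).1 hy _ (Submodule.subset_span (by simp))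
  rw [ContinuousLinearMap.adjoint_inner_left] at h2
  rw [inner_eq_zero_symm] at h1
  simp [jointForm, h1, h2]

theorem jointSpan_smul_le [CompleteSpace H] (c : ℂ) (x : H) :
    jointSpan T (c • x) ≤ jointSpan T x := by
  refine Submodule.span_le.2 ?_
  rintro _ ((rfl | ⟨k, rfl⟩) | ⟨k, rfl⟩)
  · exact Submodule.smul_mem _ _ (Submodule.subset_span (by simp))
  · simp only [map_smul]
    exact Submodule.smul_mem _ _ (Submodule.subset_span (by simp))
  · simp only [map_smul]
    exact Submodule.smul_mem _ _ (Submodule.subset_span (by simp))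

theorem norm_add_sq_of_inner_eq_zero {x y : H} (h : inner ℂ x y = 0) :
    ‖x + y‖ ^ 2 = ‖x‖ ^ 2 + ‖y‖ ^ 2 := by
  rw [norm_add_pow_two (𝕜 := ℂ), h]; simp

theorem norm_jointForm_le {x : H} (hx : ‖x‖ ≤ 1) : ‖jointForm T x‖ ≤ ∑ k, ‖T k‖ := by
  refine (pi_norm_le_iff_of_nonneg (Finset.sum_nonneg fun _ _ => norm_nonneg _)).2 fun k => ?_
  have h1 : ‖inner ℂ x (T k x)‖ ≤ ‖T k‖ := by
    refine (norm_inner_le_norm _ _).trans ?_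
    have := (T k).le_opNorm x
    nlinarith [norm_nonneg x, norm_nonneg (T k), norm_nonneg (T k x)]
  exact h1.trans (Finset.single_le_sum (f := fun k => ‖T k‖) (fun _ _ => norm_nonneg _)
    (Finset.mem_univ k))

end JointForm

/-! ### The joint essential numerical range through subspaces of finite codimension. -/

section EssentialRange

variable {H : Type*} [NormedAddCommGroup H] [InnerProductSpace ℂ H] {n : ℕ}
  (T : Fin n → H →L[ℂ] H)

theorem Orthonormal.tendsto_starProjection_zero {u : ℕ → H} (hu : Orthonormal ℂ u)
    (F : Submodule ℂ H) [FiniteDimensional ℂ F] :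
    Tendsto (fun j => F.starProjection (u j)) atTop (𝓝 0) := by
  have h1 : ∀ e : H, Tendsto (fun j => inner ℂ e (u j)) atTop (𝓝 (0 : ℂ)) := by
    intro e
    have h := (hu.inner_products_summable e).tendsto_atTop_zero
    rw [tendsto_zero_iff_norm_tendsto_zero]
    have h2 := h.sqrt
    simp only [Real.sqrt_zero, Real.sqrt_sq (norm_nonneg _)] at h2
    simpa only [norm_inner_symm] using h2
  let b := stdOrthonormalBasis ℂ F
  have h2 : ∀ x : H, F.starProjection x = ∑ i, inner ℂ (b i : H) x • (b i : H) := by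
    intro x
    have := b.starProjection_eq_sum_rankOne
    rw [this]
    simp
  simp only [h2]
  have : Tendsto (fun j => ∑ i, inner ℂ (b i : H) (u j) • (b i : H)) atTop
      (𝓝 (∑ i, (0 : ℂ) • (b i : H))) :=
    tendsto_finsetSum _ fun i _ => (h1 _).smul_const _
  simpa using this

theorem exists_seq_orthonormal_of_forall_finiteDimensional (P : ℕ → H → Prop)
    (h : ∀ N, ∀ F : Submodule ℂ H, FiniteDimensional ℂ F → ∃ x ∈ Fᗮ, ‖x‖ = 1 ∧ P N x) :
    ∃ u : ℕ → H, Orthonormal ℂ u ∧ ∃ φ : ℕ → ℕ, StrictMono φ ∧ ∀ j, P (φ j) (u j) := by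
  -- The index `N` is carried along with the vector so that the recursion can make it strictly
  -- increase.
  obtain ⟨f, hf1, hf2⟩ := exists_seq_of_forall_finset_exists
    (fun p : ℕ × H => ‖p.2‖ = 1 ∧ P p.1 p.2)
    (fun p r => p.1 < r.1 ∧ inner ℂ p.2 r.2 = 0) (by
      intro s _
      obtain ⟨x, hxF, hx1, hxP⟩ := h (s.sup Prod.fst + 1)
        (Submodule.span ℂ (Prod.snd '' (s : Set (ℕ × H))))
        (FiniteDimensional.span_of_finite ℂ (s.finite_toSet.image _))
      refine ⟨(_, x), ⟨hx1, hxP⟩, fun p hp => ⟨Nat.lt_succ_of_le (Finset.le_sup hp), ?_⟩⟩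
      exact (Submodule.mem_orthogonal _ _).1 hxF _ (Submodule.subset_span ⟨p, hp, rfl⟩))
  refine ⟨fun j => (f j).2, ⟨fun j => (hf1 j).1, ?_⟩, fun j => (f j).1,
    fun i j hij => (hf2 i j hij).1, fun j => (hf1 j).2⟩
  intro i j hij
  rcases lt_or_gt_of_ne hij with hij | hij
  · exact (hf2 i j hij).2
  · exact inner_eq_zero_symm.1 (hf2 j i hij).2

/-- By Bessel, removing the `F`-component of an orthonormal sequence changes norms and forms by
terms tending to zero. Conversely, vectors with errors tending to zero are picked one by one,
orthogonal to the earlier ones. -/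
theorem mem_jointEssentialNumericalRange_iff_forall {l : Fin n → ℂ} :
    l ∈ jointEssentialNumericalRange T ↔ ∀ F : Submodule ℂ H, FiniteDimensional ℂ F →
      ∀ ε > 0, ∃ x ∈ Fᗮ, ‖x‖ = 1 ∧ dist (jointForm T x) l < ε := by
  constructor
  · intro h F hF ε hε
    obtain ⟨u, hu, hlim⟩ := (mem_jointEssentialNumericalRange_iff T).1 h
    have hp := hu.tendsto_starProjection_zero F
    set y : ℕ → H := fun j => u j - F.starProjection (u j) with hy
    have hyn : Tendsto (fun j => ‖y j‖) atTop (𝓝 1) := by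
      have h1 : Tendsto (fun j => ‖F.starProjection (u j)‖) atTop (𝓝 0) := by
        simpa using hp.norm
      refine tendsto_of_tendsto_of_dist tendsto_const_nhds (squeeze_zero (fun _ => dist_nonneg)
        (fun j => ?_) h1)
      have := abs_norm_sub_norm_le (u j) (y j)
      rw [hu.1 j] at this
      simpa [Real.dist_eq, hy] using this
    have hyq : Tendsto (fun j => jointForm T (y j)) atTop (𝓝 l) := by
      rw [tendsto_pi_nhds] at hlim ⊢
      intro k
      have e1 : ∀ j, jointForm T (y j) k = jointForm T (u j) k
          - inner ℂ (u j) (T k (F.starProjection (u j)))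
          - inner ℂ (F.starProjection (u j)) (T k (y j)) := by
        intro j
        simp only [jointForm, hy, map_sub, inner_sub_left, inner_sub_right]
        ring
      simp only [e1]
      have z1 : Tendsto (fun j => inner ℂ (u j) (T k (F.starProjection (u j)))) atTop
          (𝓝 (0 : ℂ)) := by
        refine squeeze_zero_norm (fun j => norm_inner_le_norm _ _) ?_
        have := ((T k).continuous.tendsto 0).comp hp
        simpa [hu.1] using this.norm
      have z2 : Tendsto (fun j => inner ℂ (F.starProjection (u j)) (T k (y j))) atTop
          (𝓝 (0 : ℂ)) := by
        refine squeeze_zero_norm (a := fun j => ‖F.starProjection (u j)‖ * (‖T k‖ * ‖y j‖))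
          (fun j => (norm_inner_le_norm _ _).trans
            (mul_le_mul_of_nonneg_left ((T k).le_opNorm _) (norm_nonneg _))) ?_
        have := hp.norm.mul (hyn.const_mul ‖T k‖)
        simpa using this
      simpa using ((hlim k).sub z1).sub z2
    have hlim2 : Tendsto (fun j => (‖y j‖ ^ 2)⁻¹ • jointForm T (y j)) atTop (𝓝 l) := by
      have := ((hyn.pow 2).inv₀ (by norm_num)).smul hyq
      simpa using this
    obtain ⟨j, hj1, hj2⟩ := ((Metric.tendsto_nhds.1 hlim2 ε hε).and
      (hyn.eventually (lt_mem_nhds (show (0 : ℝ) < 1 by norm_num)))).exists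
    refine ⟨(‖y j‖⁻¹ : ℂ) • y j,
      Submodule.smul_mem _ _ (Submodule.sub_starProjection_mem_orthogonal _), ?_, ?_⟩
    · rw [norm_smul]; simp [hj2.ne']
    · rwa [jointForm_normalize T]
  · intro h
    obtain ⟨u, hu, φ, hφ, hP⟩ := exists_seq_orthonormal_of_forall_finiteDimensional
      (fun N x => dist (jointForm T x) l < 1 / ((N : ℝ) + 1))
      (fun N F hF => h F hF _ Nat.one_div_pos_of_nat)
    refine (mem_jointEssentialNumericalRange_iff T).2 ⟨u, hu, ?_⟩
    rw [tendsto_iff_dist_tendsto_zero]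
    exact squeeze_zero (fun _ => dist_nonneg) (fun j => (hP j).le)
      (tendsto_one_div_add_atTop_nhds_zero_nat.comp hφ.tendsto_atTop)

theorem jointEssentialNumericalRange_subset_closure :
    jointEssentialNumericalRange T ⊆ closure (jointNumericalRange T) := by
  intro l hl
  obtain ⟨u, hu, hlim⟩ := (mem_jointEssentialNumericalRange_iff T).1 hl
  exact mem_closure_of_tendsto hlim
    (Eventually.of_forall fun j => jointForm_mem_jointNumericalRange T (hu.1 j))

theorem constantDiagonals_subset_jointNumericalRange :
    constantDiagonals T ⊆ jointNumericalRange T := by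
  intro l hl
  obtain ⟨u, hu⟩ := (mem_constantDiagonals_iff T).1 hl
  exact (mem_jointNumericalRange_iff T).2 ⟨u 0, u.orthonormal.1 0, hu 0⟩

theorem constantDiagonals_subset_jointEssentialNumericalRange :
    constantDiagonals T ⊆ jointEssentialNumericalRange T := by
  intro l hl
  obtain ⟨u, hu⟩ := (mem_constantDiagonals_iff T).1 hl
  refine (mem_jointEssentialNumericalRange_iff T).2 ⟨u, u.orthonormal, ?_⟩
  simp only [hu]
  exact tendsto_const_nhds

theorem isClosed_jointEssentialNumericalRange : IsClosed (jointEssentialNumericalRange T) := by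
  refine isClosed_of_closure_subset fun l hl => ?_
  refine (mem_jointEssentialNumericalRange_iff_forall T).2 fun F hF ε hε => ?_
  obtain ⟨l', hl', hd⟩ := Metric.mem_closure_iff.1 hl (ε / 2) (by positivity)
  obtain ⟨x, hxF, hx1, hx⟩ :=
    (mem_jointEssentialNumericalRange_iff_forall T).1 hl' F hF (ε / 2) (by positivity)
  rw [dist_comm] at hd
  exact ⟨x, hxF, hx1, by linarith [dist_triangle (jointForm T x) l' l]⟩

/-- For approximating `x` and an independent approximating `y`, the unit vector `√a x + √b y` has as
its value exactly the convex combination of theirs. -/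
theorem convex_jointEssentialNumericalRange [CompleteSpace H] :
    Convex ℝ (jointEssentialNumericalRange T) := by
  intro l hl m hm a b ha hb hab
  refine (mem_jointEssentialNumericalRange_iff_forall T).2 fun F hF ε hε => ?_
  obtain ⟨x, hxF, hx1, hx⟩ := (mem_jointEssentialNumericalRange_iff_forall T).1 hl F hF ε hε
  obtain ⟨y, hyF, hy1, hy⟩ := (mem_jointEssentialNumericalRange_iff_forall T).1 hm
    (F ⊔ jointSpan T ((√a : ℂ) • x)) inferInstance ε hε
  have hyF1 : y ∈ Fᗮ := Submodule.orthogonal_le le_sup_left hyF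
  have hyF2 : (√b : ℂ) • y ∈ (jointSpan T ((√a : ℂ) • x))ᗮ :=
    Submodule.smul_mem _ _ (Submodule.orthogonal_le le_sup_right hyF)
  refine ⟨(√a : ℂ) • x + (√b : ℂ) • y,
    Submodule.add_mem _ (Submodule.smul_mem _ _ hxF) (Submodule.smul_mem _ _ hyF1), ?_, ?_⟩
  · rw [← sq_eq_sq₀ (norm_nonneg _) zero_le_one,
      norm_add_sq_of_inner_eq_zero (inner_eq_zero_of_mem_jointSpan_orthogonal T hyF2),
      norm_sqrt_smul_sq ha, norm_sqrt_smul_sq hb, hx1, hy1]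
    linarith
  · rw [jointForm_add_of_mem_jointSpan_orthogonal T hyF2, jointForm_sqrt_smul T ha,
      jointForm_sqrt_smul T hb]
    have := (convex_ball (0 : Fin n → ℂ) ε) (mem_ball_zero_iff.2 (by rwa [← dist_eq_norm]))
      (mem_ball_zero_iff.2 (by rwa [← dist_eq_norm])) ha hb hab (x := jointForm T x - l)
      (y := jointForm T y - m)
    rw [mem_ball_zero_iff] at this
    rw [dist_eq_norm]
    refine lt_of_eq_of_lt (congrArg _ ?_) this
    module

theorem exists_mem_orthogonal_norm_eq_one (hH : ¬ FiniteDimensional ℂ H) (F : Submodule ℂ H)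
    [FiniteDimensional ℂ F] : ∃ x ∈ Fᗮ, ‖x‖ = 1 := by
  have : Fᗮ ≠ ⊥ := by
    rw [Ne, Submodule.orthogonal_eq_bot_iff]
    rintro rfl
    exact hH (Module.Finite.equiv (Submodule.topEquiv (R := ℂ) (M := H)))
  obtain ⟨y, hy, hy0⟩ := Submodule.exists_mem_ne_zero_of_ne_bot this
  exact ⟨(‖y‖⁻¹ : ℂ) • y, Submodule.smul_mem _ _ hy, by rw [norm_smul]; simp [hy0]⟩

end EssentialRange

/-! ### Semidefinite forms attached to functionals bounded above on the numerical range. -/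

section DefectForm

variable {H : Type*} [NormedAddCommGroup H] [InnerProductSpace ℂ H] {n : ℕ}
  (T : Fin n → H →L[ℂ] H) (f : (Fin n → ℂ) →L[ℝ] ℝ) (M : ℝ)

/-- The real quadratic form `x ↦ M ‖x‖² - f (⟨T₁x, x⟩, …, ⟨Tₙx, x⟩)`. -/
noncomputable def defectForm (x : H) : ℝ := M * ‖x‖ ^ 2 - f (jointForm T x)

theorem continuous_defectForm : Continuous (defectForm T f M) :=
  ((continuous_norm.pow 2).const_mul M).sub (f.continuous.comp (continuous_jointForm T))

theorem defectForm_smul (c : ℂ) (x : H) :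
    defectForm T f M (c • x) = ‖c‖ ^ 2 * defectForm T f M x := by
  simp only [defectForm, jointForm_smul, norm_smul, map_smul, smul_eq_mul]
  ring

theorem defectForm_zero : defectForm T f M 0 = 0 := by
  simpa using defectForm_smul T f M 0 (0 : H)

theorem defectForm_add_add_defectForm_sub (x y : H) :
    defectForm T f M (x + y) + defectForm T f M (x - y) =
      2 * (defectForm T f M x + defectForm T f M y) := by
  have h1 := congrArg f (jointForm_add_add_jointForm_sub T x y)
  simp only [map_add, map_smul, smul_eq_mul] at h1
  have h2 := parallelogram_law_with_norm ℂ x y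
  simp only [defectForm]
  linear_combination M * h2 - h1

variable {T f M}

theorem le_defectForm_of_forall_norm_eq_one {F : Submodule ℂ H} {ε : ℝ}
    (h : ∀ x ∈ F, ‖x‖ = 1 → ε ≤ defectForm T f M x) {x : H} (hx : x ∈ F) :
    ε * ‖x‖ ^ 2 ≤ defectForm T f M x := by
  rcases eq_or_ne x 0 with rfl | hx0
  · simp [defectForm_zero]
  · have hpos : 0 < ‖x‖ := norm_pos_iff.2 hx0
    have := h ((‖x‖⁻¹ : ℂ) • x) (F.smul_mem _ hx) (by rw [norm_smul]; simp [hx0])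
    rw [defectForm_smul, norm_inv, Complex.norm_real, norm_norm, inv_pow,
      le_inv_mul_iff₀ (by positivity)] at this
    linarith

theorem defectForm_nonneg (hM : ∀ l ∈ jointNumericalRange T, f l ≤ M) (x : H) :
    0 ≤ defectForm T f M x := by
  have := le_defectForm_of_forall_norm_eq_one (T := T) (f := f) (M := M) (F := ⊤) (ε := 0)
    (fun x _ hx => by
      have := hM _ (jointForm_mem_jointNumericalRange T hx)
      simp only [defectForm, hx]
      linarith) (x := x) trivial
  simpa using this

theorem defectForm_add_le (hM : ∀ l ∈ jointNumericalRange T, f l ≤ M) (x y : H) :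
    defectForm T f M (x + y) ≤ 2 * (defectForm T f M x + defectForm T f M y) := by
  have h1 := defectForm_add_add_defectForm_sub T f M x y
  have h2 := defectForm_nonneg hM (x - y)
  linarith

theorem defectForm_sub_le (hM : ∀ l ∈ jointNumericalRange T, f l ≤ M) (x y : H) :
    defectForm T f M (x - y) ≤ 2 * (defectForm T f M x + defectForm T f M y) := by
  have h1 := defectForm_add_add_defectForm_sub T f M x y
  have h2 := defectForm_nonneg hM (x + y)
  linarith

/-- In a minimizing sequence the `F`-components converge along a subsequence by compactness, and the
components in `Fᗮ` are then Cauchy because the form is coercive there. -/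
theorem exists_defectForm_eq_zero [CompleteSpace H]
    (hM : ∀ l ∈ jointNumericalRange T, f l ≤ M) (F : Submodule ℂ H) [FiniteDimensional ℂ F]
    {ε : ℝ} (hε : 0 < ε) (hF : ∀ y ∈ Fᗮ, ε * ‖y‖ ^ 2 ≤ defectForm T f M y) {x : ℕ → H}
    (hx : ∀ j, ‖x j‖ = 1) (hlim : Tendsto (fun j => defectForm T f M (x j)) atTop (𝓝 0)) :
    ∃ z : H, ‖z‖ = 1 ∧ defectForm T f M z = 0 := by
  have := FiniteDimensional.proper ℂ F
  obtain ⟨a, -, φ, hφ, ha⟩ := tendsto_subseq_of_bounded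
    (Metric.isBounded_closedBall (x := (0 : F)) (r := 1))
    (x := fun j => F.orthogonalProjectionOnto (x j)) (fun j => by
      rw [mem_closedBall_zero_iff]
      exact (F.norm_orthogonalProjectionOnto_apply_le _).trans (hx j).le)
  set p : ℕ → H := fun j => F.starProjection (x (φ j)) with hp
  have hpa : Tendsto p atTop (𝓝 (a : H)) := (continuous_subtype_val.tendsto a).comp ha
  set y : ℕ → H := fun j => x (φ j) - p j with hy
  have hyF : ∀ j, y j ∈ Fᗮ := fun j => Submodule.sub_starProjection_mem_orthogonal _
  -- The factor 4 comes from two nested uses of `defectForm_sub_le` on `y i - y j = (x (φ i) - x (φ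
  -- j)) - (p i - p j)`.
  set c : ℕ → ℝ := fun j => 4 * defectForm T f M (x (φ j)) + 4 * defectForm T f M (p j - a) with hc
  have hc0 : Tendsto c atTop (𝓝 0) := by
    have h1 : Tendsto (fun j => defectForm T f M (p j - a)) atTop (𝓝 0) := by
      have h := ((continuous_defectForm T f M).tendsto 0).comp
        (show Tendsto (fun j => p j - (a : H)) atTop (𝓝 0) by
          simpa using hpa.sub_const (a : H))
      rwa [defectForm_zero] at h
    simpa using ((hlim.comp hφ.tendsto_atTop).const_mul 4).add (h1.const_mul 4)
  have hyc : ∀ i j, ε * ‖y i - y j‖ ^ 2 ≤ c i + c j := by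
    intro i j
    have h1 := hF _ (Submodule.sub_mem _ (hyF i) (hyF j))
    have h2 := defectForm_sub_le hM (x (φ i) - x (φ j)) (p i - p j)
    have h3 := defectForm_sub_le hM (x (φ i)) (x (φ j))
    have h4 := defectForm_sub_le hM (p i - a) (p j - a)
    rw [sub_sub_sub_cancel_right] at h4
    rw [show x (φ i) - x (φ j) - (p i - p j) = y i - y j by simp only [hy]; abel] at h2
    simp only [hc]
    linarith
  have hcau : CauchySeq y := by
    refine Metric.cauchySeq_iff.2 fun δ hδ => ?_
    obtain ⟨N, hN⟩ := eventually_atTop.1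
      (hc0.eventually (gt_mem_nhds (show 0 < ε * δ ^ 2 / 2 by positivity)))
    refine ⟨N, fun i hi j hj => ?_⟩
    have h1 : ε * ‖y i - y j‖ ^ 2 < ε * δ ^ 2 := by linarith [hyc i j, hN i hi, hN j hj]
    rw [dist_eq_norm]
    exact lt_of_pow_lt_pow_left₀ 2 hδ.le (lt_of_mul_lt_mul_left h1 hε.le)
  obtain ⟨b, hb⟩ := cauchySeq_tendsto_of_complete hcau
  have hxz : Tendsto (fun j => x (φ j)) atTop (𝓝 (b + a)) := by
    simpa [hy] using hb.add hpa
  refine ⟨b + a, ?_, ?_⟩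
  · refine tendsto_nhds_unique hxz.norm ?_
    simp only [hx]
    exact tendsto_const_nhds
  · exact tendsto_nhds_unique (((continuous_defectForm T f M).tendsto _).comp hxz)
      (hlim.comp hφ.tendsto_atTop)

theorem Orthonormal.exists_subseq_tendsto_jointForm (T : Fin n → H →L[ℂ] H) {u : ℕ → H}
    (hu : Orthonormal ℂ u) : ∃ l ∈ jointEssentialNumericalRange T, ∃ φ : ℕ → ℕ, StrictMono φ ∧
      Tendsto (fun j => jointForm T (u (φ j))) atTop (𝓝 l) := by
  obtain ⟨l, -, φ, hφ, hl⟩ := tendsto_subseq_of_bounded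
    (Metric.isBounded_closedBall (x := (0 : Fin n → ℂ)) (r := ∑ k, ‖T k‖))
    (x := fun j => jointForm T (u j))
    (fun j => mem_closedBall_zero_iff.2 (norm_jointForm_le T (hu.1 j).le))
  exact ⟨l, (mem_jointEssentialNumericalRange_iff T).2 ⟨u ∘ φ, hu.comp φ hφ.injective, hl⟩,
    φ, hφ, hl⟩

theorem jointEssentialNumericalRange_nonempty (hH : ¬ FiniteDimensional ℂ H)
    (T : Fin n → H →L[ℂ] H) : (jointEssentialNumericalRange T).Nonempty := by
  obtain ⟨u, hu, -⟩ := exists_seq_orthonormal_of_forall_finiteDimensional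
    (fun _ (_ : H) => True) (fun N F hF => by
      simpa using exists_mem_orthogonal_norm_eq_one hH F)
  obtain ⟨l, hl, -⟩ := hu.exists_subseq_tendsto_jointForm T
  exact ⟨l, hl⟩

/-- The supremum of a real functional over the joint numerical range is attained there or on the
joint essential numerical range. -/
theorem exists_mem_eq_of_isLUB [CompleteSpace H] (hM : IsLUB (f '' jointNumericalRange T) M) :
    (∃ l ∈ jointNumericalRange T, f l = M) ∨ ∃ l ∈ jointEssentialNumericalRange T, f l = M := by
  have hM' : ∀ l ∈ jointNumericalRange T, f l ≤ M := fun l hl => hM.1 (mem_image_of_mem f hl)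
  rw [or_iff_not_imp_left]
  intro hna
  have hdef : ∀ z : H, ‖z‖ = 1 → defectForm T f M z = M - f (jointForm T z) := fun z hz => by
    simp [defectForm, hz]
  have hna' : ∀ z : H, ‖z‖ = 1 → defectForm T f M z ≠ 0 := fun z hz h0 => hna
    ⟨_, jointForm_mem_jointNumericalRange T hz, by rw [hdef z hz] at h0; linarith⟩
  have happrox : ∀ j : ℕ, ∃ x : H, ‖x‖ = 1 ∧ defectForm T f M x < 1 / ((j : ℝ) + 1) := by
    intro j
    obtain ⟨_, ⟨l, hl, rfl⟩, h1, -⟩ := hM.exists_between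
      (show M - 1 / ((j : ℝ) + 1) < M by linarith [Nat.one_div_pos_of_nat (α := ℝ) (n := j)])
    obtain ⟨x, hx, rfl⟩ := (mem_jointNumericalRange_iff T).1 hl
    exact ⟨x, hx, by rw [hdef x hx]; linarith⟩
  choose x hx1 hx2 using happrox
  have hxlim : Tendsto (fun j => defectForm T f M (x j)) atTop (𝓝 0) :=
    squeeze_zero (fun j => defectForm_nonneg hM' _) (fun j => (hx2 j).le)
      tendsto_one_div_add_atTop_nhds_zero_nat
  -- A positive lower bound on the unit sphere of some `Fᗮ` would make the supremum attained on `W`;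
  -- so nearly null unit vectors exist in every `Fᗮ`.
  obtain ⟨u, hu, φ, hφ, huP⟩ := exists_seq_orthonormal_of_forall_finiteDimensional
    (fun N (z : H) => defectForm T f M z < 1 / ((N : ℝ) + 1)) (fun N F hF => by
      by_contra! hcon
      obtain ⟨z, hz, hz0⟩ := exists_defectForm_eq_zero hM' F
        (Nat.one_div_pos_of_nat (α := ℝ) (n := N))
        (fun y hy => le_defectForm_of_forall_norm_eq_one hcon hy) hx1 hxlim
      exact hna' z hz hz0)
  obtain ⟨l, hl, ψ, hψ, hlim⟩ := hu.exists_subseq_tendsto_jointForm T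
  refine ⟨l, hl, ?_⟩
  have h1 : Tendsto (fun j => defectForm T f M (u (ψ j))) atTop (𝓝 0) :=
    squeeze_zero (fun j => defectForm_nonneg hM' _) (fun j => (huP _).le)
      (tendsto_one_div_add_atTop_nhds_zero_nat.comp (hφ.comp hψ).tendsto_atTop)
  simp only [hdef _ (hu.1 _)] at h1
  have h2 := ((f.continuous.tendsto l).comp hlim).const_sub M
  linarith [tendsto_nhds_unique h1 h2]

/-- The null set of a nonnegative quadratic form is a closed subspace; here it contains an
orthonormal basis. -/
theorem eq_of_mem_constantDiagonals_of_forall_le {w : Fin n → ℂ} (hw : w ∈ constantDiagonals T)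
    (hM : ∀ l ∈ jointNumericalRange T, f l ≤ f w) : ∀ l ∈ jointNumericalRange T, f l = f w := by
  obtain ⟨u, hu⟩ := (mem_constantDiagonals_iff T).1 hw
  let S : Submodule ℂ H :=
    { carrier := {x | defectForm T f (f w) x = 0}
      add_mem' := fun {x y} hx hy => by
        have h1 := defectForm_add_le hM x y
        have h2 := defectForm_nonneg hM (x + y)
        change defectForm T f (f w) x = 0 at hx
        change defectForm T f (f w) y = 0 at hy
        change defectForm T f (f w) (x + y) = 0
        linarith
      zero_mem' := defectForm_zero T f (f w)
      smul_mem' := fun c x hx => by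
        change defectForm T f (f w) x = 0 at hx
        change defectForm T f (f w) (c • x) = 0
        rw [defectForm_smul, hx, mul_zero] }
  have hSc : IsClosed (S : Set H) :=
    isClosed_eq (continuous_defectForm T f (f w)) continuous_const
  have hS : ∀ x : H, x ∈ S := by
    intro x
    have h1 : Submodule.span ℂ (range u) ≤ S := by
      rw [Submodule.span_le]
      rintro _ ⟨j, rfl⟩
      change defectForm T f (f w) (u j) = 0
      simp [defectForm, hu j, u.orthonormal.1 j]
    have h2 := Submodule.topologicalClosure_minimal _ h1 hSc
    rw [u.dense_span] at h2
    exact h2 trivial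
  intro l hl
  obtain ⟨x, hx, rfl⟩ := (mem_jointNumericalRange_iff T).1 hl
  have : defectForm T f (f w) x = 0 := hS x
  simp only [defectForm, hx] at this
  linarith

end DefectForm

/-! ### Construction of constant diagonals, and the inclusions between the three sets. -/

section Diagonals

variable {H : Type*} [NormedAddCommGroup H] [InnerProductSpace ℂ H] [CompleteSpace H] {n : ℕ}
  {T : Fin n → H →L[ℂ] H}

/-- The vectors realizing the `g i` are chosen independent of one another, so the combination with
coefficients `√(t i)` works for all weights at once. The order of quantifiers matters: the weights
are later chosen depending on `g`. -/
theorem exists_near_forall_nonneg_exists_jointForm_eq_sum {ε : ℝ} (hε : 0 < ε) {m : ℕ}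
    (d : Fin m → Fin n → ℂ) (hd : ∀ i, d i ∈ jointEssentialNumericalRange T)
    (F : Submodule ℂ H) [FiniteDimensional ℂ F] :
    ∃ g : Fin m → Fin n → ℂ, (∀ i, g i ∈ jointNumericalRange T) ∧ (∀ i, dist (g i) (d i) < ε) ∧
      ∀ t : Fin m → ℝ, (∀ i, 0 ≤ t i) →
        ∃ x ∈ Fᗮ, ‖x‖ ^ 2 = ∑ i, t i ∧ jointForm T x = ∑ i, t i • g i := by
  induction m generalizing F with
  | zero =>
    exact ⟨Fin.elim0, fun i => i.elim0, fun i => i.elim0, fun t _ =>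
      ⟨0, Submodule.zero_mem _, by simp, by simpa using jointForm_smul T 0 (0 : H)⟩⟩
  | succ m ih =>
    obtain ⟨x, hxF, hx1, hx⟩ :=
      (mem_jointEssentialNumericalRange_iff_forall T).1 (hd 0) F inferInstance ε hε
    obtain ⟨g, hgW, hgd, hg⟩ := ih (fun i => d i.succ) (fun i => hd _) (F ⊔ jointSpan T x)
    refine ⟨Fin.cons (jointForm T x) g, fun i => ?_, fun i => ?_, fun t ht => ?_⟩
    · refine Fin.cases ?_ (fun i => ?_) i
      · exact jointForm_mem_jointNumericalRange T hx1
      · exact hgW i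
    · refine Fin.cases ?_ (fun i => ?_) i
      · exact hx
      · exact hgd i
    · obtain ⟨y, hy, hy1, hy2⟩ := hg (fun i => t i.succ) (fun i => ht _)
      have hyF : y ∈ Fᗮ := Submodule.orthogonal_le le_sup_left hy
      have hyx : y ∈ (jointSpan T ((√(t 0) : ℂ) • x))ᗮ := Submodule.orthogonal_le
        ((jointSpan_smul_le T _ x).trans le_sup_right) hy
      refine ⟨(√(t 0) : ℂ) • x + y,
        Submodule.add_mem _ (Submodule.smul_mem _ _ hxF) hyF, ?_, ?_⟩
      · rw [norm_add_sq_of_inner_eq_zero (inner_eq_zero_of_mem_jointSpan_orthogonal T hyx),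
          norm_sqrt_smul_sq (ht 0), hx1, hy1, Fin.sum_univ_succ]
        ring
      · rw [jointForm_add_of_mem_jointSpan_orthogonal T hyx, jointForm_sqrt_smul T (ht 0), hy2,
          Fin.sum_univ_succ]
        simp

/-- Points of `W_e` are only approximated by values, but `w` remains a convex combination of the
approximating values; `hW` keeps these in the affine span. -/
theorem exists_mem_orthogonal_jointForm_eq
    (hW : jointNumericalRange T ⊆ affineSpan ℝ (jointEssentialNumericalRange T)) {w : Fin n → ℂ}
    (hw : w ∈ intrinsicInterior ℝ (jointEssentialNumericalRange T)) (F : Submodule ℂ H)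
    [FiniteDimensional ℂ F] : ∃ x ∈ Fᗮ, ‖x‖ = 1 ∧ jointForm T x = w := by
  obtain ⟨ε, hε, m, d, hd, h⟩ := exists_forall_perturbation_exists_stdSimplex hw
  obtain ⟨g, hgW, hgd, hg⟩ := exists_near_forall_nonneg_exists_jointForm_eq_sum hε d hd F
  obtain ⟨t, ht, htw⟩ := h g (fun i => hW (hgW i)) hgd
  obtain ⟨x, hxF, hx1, hx2⟩ := hg t ht.1
  refine ⟨x, hxF, ?_, hx2.trans htw⟩
  rw [← sq_eq_sq₀ (norm_nonneg _) zero_le_one, hx1, ht.2, one_pow]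

/-- A unit vector `u` orthogonal to `F` with prescribed value of the joint form can be chosen so
that adding it to `F` reduces the squared distance to `y` by a factor independent of `F`, `y`. -/
theorem exists_infDist_sup_span_singleton_le (hH : ¬ FiniteDimensional ℂ H)
    (hW : jointNumericalRange T ⊆ affineSpan ℝ (jointEssentialNumericalRange T)) {w : Fin n → ℂ}
    (hw : w ∈ intrinsicInterior ℝ (jointEssentialNumericalRange T)) :
    ∃ κ : ℝ, κ < 1 ∧ ∀ F : Submodule ℂ H, FiniteDimensional ℂ F → ∀ y : H,
      ∃ u ∈ Fᗮ, ‖u‖ = 1 ∧ jointForm T u = w ∧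
        Metric.infDist y (F ⊔ Submodule.span ℂ {u} : Submodule ℂ H) ^ 2 ≤
          κ * Metric.infDist y F ^ 2 := by
  obtain ⟨r, hr, hb⟩ := exists_forall_dist_lt_mem_intrinsicInterior hw
  have hwA := subset_affineSpan ℝ _ (intrinsicInterior_subset hw)
  -- `D` bounds the distance from `w` to any value in `W`, so moving from `w` by `s` times such a
  -- difference stays within `r`. The weight `α` solves `α • q + (1 - α) • (w - s • (q - w)) = w`
  -- for every `q`.
  set D : ℝ := ∑ k, ‖T k‖ + ‖w‖ with hD
  have hD0 : 0 ≤ D := by positivity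
  set s : ℝ := r / (D + 1) with hs
  have hs0 : 0 < s := by positivity
  have hsD : s * D < r := by
    rw [hs, div_mul_eq_mul_div, div_lt_iff₀ (by positivity)]
    nlinarith
  set α : ℝ := s / (1 + s) with hα
  have hα0 : 0 < α := by positivity
  have hα1 : 1 - α = 1 / (1 + s) := by rw [hα]; field_simp; ring
  have hα1' : 0 ≤ 1 - α := by rw [hα1]; positivity
  refine ⟨1 - α, by linarith, fun F hF y => ?_⟩
  set z := y - F.starProjection y with hz
  have hzF : z ∈ Fᗮ := Submodule.sub_starProjection_mem_orthogonal y
  obtain ⟨e, heF, he1, hze⟩ : ∃ e ∈ Fᗮ, ‖e‖ = 1 ∧ z = (‖z‖ : ℂ) • e := by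
    rcases eq_or_ne z 0 with h0 | h0
    · obtain ⟨e, heF, he⟩ := exists_mem_orthogonal_norm_eq_one hH F
      exact ⟨e, heF, he, by simp [h0]⟩
    · refine ⟨(‖z‖⁻¹ : ℂ) • z, Submodule.smul_mem _ _ hzF, by rw [norm_smul]; simp [h0], ?_⟩
      rw [smul_smul, mul_inv_cancel₀ (by simpa using h0), one_smul]
  -- The compensating value lies on the far side of `w` from the value at `e`.
  set v : Fin n → ℂ := AffineMap.lineMap w (jointForm T e) (-s) with hv
  have hvI : v ∈ intrinsicInterior ℝ (jointEssentialNumericalRange T) := by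
    refine hb v (AffineMap.lineMap_mem _ hwA (hW (jointForm_mem_jointNumericalRange T he1))) ?_
    rw [hv, dist_lineMap_left, norm_neg, Real.norm_of_nonneg hs0.le]
    refine lt_of_le_of_lt (mul_le_mul_of_nonneg_left ?_ hs0.le) hsD
    rw [dist_comm, dist_eq_norm]
    exact (norm_sub_le _ _).trans (by linarith [norm_jointForm_le T he1.le])
  obtain ⟨x, hx, hx1, hxv⟩ := exists_mem_orthogonal_jointForm_eq hW hvI (F ⊔ jointSpan T e)
  have hxF : x ∈ Fᗮ := Submodule.orthogonal_le le_sup_left hx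
  have hxe : x ∈ (jointSpan T e)ᗮ := Submodule.orthogonal_le le_sup_right hx
  have hxe' : (√(1 - α) : ℂ) • x ∈ (jointSpan T ((√α : ℂ) • e))ᗮ :=
    Submodule.smul_mem _ _ (Submodule.orthogonal_le (jointSpan_smul_le T _ e) hxe)
  set u : H := (√α : ℂ) • e + (√(1 - α) : ℂ) • x with hu
  have huF : u ∈ Fᗮ := Submodule.add_mem _ (Submodule.smul_mem _ _ heF) (Submodule.smul_mem _ _ hxF)
  have hu1 : ‖u‖ = 1 := by
    rw [← sq_eq_sq₀ (norm_nonneg _) zero_le_one, hu,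
      norm_add_sq_of_inner_eq_zero (inner_eq_zero_of_mem_jointSpan_orthogonal T hxe'),
      norm_sqrt_smul_sq hα0.le, norm_sqrt_smul_sq hα1', he1, hx1]
    ring
  refine ⟨u, huF, hu1, ?_, ?_⟩
  · rw [hu, jointForm_add_of_mem_jointSpan_orthogonal T hxe', jointForm_sqrt_smul T hα0.le,
      jointForm_sqrt_smul T hα1', hxv, hv, AffineMap.lineMap_apply_module, smul_add, smul_smul,
      smul_smul, show (1 - α) * (1 - -s) = 1 by rw [hα1]; field_simp; ring,
      show (1 - α) * -s = -α by rw [hα1, hα]; ring]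
    module
  · have h1 : Metric.infDist y (F ⊔ Submodule.span ℂ {u} : Submodule ℂ H) ≤
        ‖z - ((√α * ‖z‖ : ℝ) : ℂ) • u‖ := by
      have := Metric.infDist_le_dist_of_mem (x := y)
        (s := (F ⊔ Submodule.span ℂ {u} : Submodule ℂ H))
        (Submodule.add_mem_sup (F.starProjection_apply_mem y) (Submodule.smul_mem _
          ((√α * ‖z‖ : ℝ) : ℂ) (Submodule.mem_span_singleton_self u)))
      rwa [dist_eq_norm, ← sub_sub] at this
    have h2 : ‖z‖ ≤ Metric.infDist y F := by
      refine (Metric.le_infDist ⟨0, F.zero_mem⟩).2 fun v hv => ?_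
      rw [hz, Submodule.starProjection_minimal, dist_eq_norm]
      exact ciInf_le (f := fun v : F => ‖y - v‖)
        ⟨0, by rintro _ ⟨v, rfl⟩; exact norm_nonneg _⟩ ⟨v, hv⟩
    have h3 : inner ℂ z u = ((√α * ‖z‖ : ℝ) : ℂ) := by
      have hex := inner_eq_zero_of_mem_jointSpan_orthogonal T hxe
      rw [hze, hu, inner_smul_left, inner_add_right, inner_smul_right, inner_smul_right, hex,
        inner_self_eq_norm_sq_to_K, he1, norm_smul, he1]
      simp [mul_comm]
    -- The component of the residual `z` along `u` has length `√α * ‖z‖`, whatever `F` and `y` are.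
    have h4 : ‖z - ((√α * ‖z‖ : ℝ) : ℂ) • u‖ ^ 2 = (1 - α) * ‖z‖ ^ 2 := by
      rw [norm_sub_pow_two (𝕜 := ℂ), inner_smul_right, h3, norm_smul, hu1, ← Complex.ofReal_mul,
        Complex.norm_real, mul_one, Real.norm_eq_abs, sq_abs]
      change ‖z‖ ^ 2 - 2 * (√α * ‖z‖ * (√α * ‖z‖)) + _ = _
      linear_combination (-‖z‖ ^ 2) * Real.sq_sqrt hα0.le
    calc _ ≤ ‖z - ((√α * ‖z‖ : ℝ) : ℂ) • u‖ ^ 2 :=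
          pow_le_pow_left₀ Metric.infDist_nonneg h1 2
      _ = (1 - α) * ‖z‖ ^ 2 := h4
      _ ≤ _ := mul_le_mul_of_nonneg_left (pow_le_pow_left₀ (norm_nonneg _) h2 2) hα1'

theorem intrinsicInterior_jointEssentialNumericalRange_subset_constantDiagonals
    [TopologicalSpace.SeparableSpace H] (hH : ¬ FiniteDimensional ℂ H)
    (hW : jointNumericalRange T ⊆ affineSpan ℝ (jointEssentialNumericalRange T)) :
    intrinsicInterior ℝ (jointEssentialNumericalRange T) ⊆ constantDiagonals T := by
  intro w hw
  obtain ⟨κ, hκ, hstep⟩ := exists_infDist_sup_span_singleton_le hH hW hw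
  choose U hUF hU1 hUw hUd using fun (F : {F : Submodule ℂ H // FiniteDimensional ℂ F}) =>
    hstep F.1 F.2
  let y := TopologicalSpace.denseSeq H
  -- The first component of `Nat.unpair k` takes every value infinitely often, so each vector of the
  -- dense sequence is targeted infinitely many times.
  let G : ℕ → {F : Submodule ℂ H // FiniteDimensional ℂ F} := fun k =>
    Nat.rec ⟨⊥, inferInstance⟩ (fun k F => ⟨F.1 ⊔ Submodule.span ℂ {U F (y (Nat.unpair k).1)}, by
      have := F.2
      infer_instance⟩) k
  let u : ℕ → H := fun k => U (G k) (y (Nat.unpair k).1)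
  have hG : ∀ k, (G (k + 1)).1 = (G k).1 ⊔ Submodule.span ℂ {u k} := fun k => rfl
  have hGmono : Monotone fun k => (G k).1 := monotone_nat_of_le_succ fun k => by
    rw [hG]; exact le_sup_left
  have huG : ∀ i j, i < j → u i ∈ (G j).1 := fun i j hij => hGmono (Nat.succ_le_of_lt hij) (by
    change u i ∈ (G (i + 1)).1
    rw [hG]; exact Submodule.mem_sup_right (Submodule.mem_span_singleton_self _))
  have hGu : ∀ k, (G k).1 ≤ Submodule.span ℂ (range u) := by
    intro k
    induction k with
    | zero => exact bot_le
    | succ k ih =>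
      rw [hG]
      exact sup_le ih (Submodule.span_mono (singleton_subset_iff.2 ⟨k, rfl⟩))
  have hlt : ∀ i j, i < j → inner ℂ (u i) (u j) = 0 := fun i j hij =>
    (Submodule.mem_orthogonal _ _).1 (hUF (G j) _) _ (huG i j hij)
  have horth : Orthonormal ℂ u := by
    refine ⟨fun k => hU1 _ _, fun i j hij => ?_⟩
    rcases lt_or_gt_of_ne hij with h | h
    · exact hlt i j h
    · exact inner_eq_zero_symm.1 (hlt j i h)
  have hdense : ∀ m, y m ∈ closure (Submodule.span ℂ (range u) : Set H) := by
    intro m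
    set a : ℕ → ℝ := fun k => Metric.infDist (y m) (G k).1 with ha
    have ha0 : ∀ k, 0 ≤ a k := fun k => Metric.infDist_nonneg
    have hanti : Antitone a := fun i j hij =>
      Metric.infDist_le_infDist_of_subset (hGmono hij) ⟨0, Submodule.zero_mem _⟩
    have hlim := tendsto_atTop_ciInf hanti ⟨0, by rintro _ ⟨k, rfl⟩; exact ha0 k⟩
    set ℓ := ⨅ k, a k
    have hpair : Tendsto (fun j => Nat.pair m j) atTop atTop :=
      tendsto_atTop_mono (fun j => Nat.right_le_pair m j) tendsto_id
    have hle : ∀ j, a (Nat.pair m j + 1) ^ 2 ≤ κ * a (Nat.pair m j) ^ 2 := by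
      intro j
      have := hUd (G (Nat.pair m j)) (y (Nat.unpair (Nat.pair m j)).1)
      rw [Nat.unpair_pair] at this
      simp only [ha, hG, u, Nat.unpair_pair]
      exact this
    -- The distances decrease to `ℓ`; passing to the limit along the steps that target `y m` forces
    -- `ℓ = 0`, as `κ < 1`.
    have h1 : ℓ ^ 2 ≤ κ * ℓ ^ 2 := le_of_tendsto_of_tendsto'
      ((((tendsto_add_atTop_iff_nat 1).2 hlim).comp hpair).pow 2)
      (((hlim.comp hpair).pow 2).const_mul κ) hle
    have h2 : ℓ = 0 := by
      by_contra h
      have : 0 < ℓ ^ 2 := by positivity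
      nlinarith
    rw [h2] at hlim
    refine Metric.mem_closure_iff.2 fun ε hε => ?_
    obtain ⟨k, hk⟩ := (hlim.eventually (gt_mem_nhds hε)).exists
    obtain ⟨v, hv, hd⟩ := (Metric.infDist_lt_iff ⟨0, Submodule.zero_mem _⟩).1 hk
    exact ⟨v, hGu k hv, hd⟩
  have htop : ⊤ ≤ (Submodule.span ℂ (range u)).topologicalClosure := by
    intro x _
    have h1 : closure (range y) ⊆ closure (Submodule.span ℂ (range u) : Set H) :=
      closure_minimal (range_subset_iff.2 hdense) isClosed_closure
    exact h1 (TopologicalSpace.denseRange_denseSeq H x)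
  refine (mem_constantDiagonals_iff T).2 ⟨HilbertBasis.mk horth htop, fun j => ?_⟩
  rw [HilbertBasis.coe_mk]
  exact hUw _ _

/-- Separate a stray point from `W_e` by `f`. The supremum of `f` over `W` cannot be reached on
`W_e`; if reached on `W`, relative openness makes `f` constant on `W`, hence on `closure W ⊇ W_e`,
which is absurd since `W_e` is nonempty. -/
theorem jointNumericalRange_subset_jointEssentialNumericalRange (hH : ¬ FiniteDimensional ℂ H)
    (hopen : jointNumericalRange T ⊆ intrinsicInterior ℝ (jointNumericalRange T)) :
    jointNumericalRange T ⊆ jointEssentialNumericalRange T := by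
  intro l hl
  by_contra hlE
  obtain ⟨f, c, hfc, hcl⟩ := geometric_hahn_banach_closed_point
    (convex_jointEssentialNumericalRange T) (isClosed_jointEssentialNumericalRange T) hlE
  have hbdd : BddAbove (f '' jointNumericalRange T) := by
    refine ⟨‖f‖ * ∑ k, ‖T k‖, ?_⟩
    rintro _ ⟨m, hm, rfl⟩
    obtain ⟨x, hx, rfl⟩ := (mem_jointNumericalRange_iff T).1 hm
    exact (le_abs_self _).trans ((f.le_opNorm _).trans
      (mul_le_mul_of_nonneg_left (norm_jointForm_le T hx.le) (norm_nonneg f)))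
  have hlub := isLUB_csSup ⟨f l, mem_image_of_mem f hl⟩ hbdd
  set M := sSup (f '' jointNumericalRange T)
  have hM : ∀ m ∈ jointNumericalRange T, f m ≤ M := fun m hm => hlub.1 (mem_image_of_mem f hm)
  obtain ⟨p, hp, hpM⟩ | ⟨p, hp, hpM⟩ := exists_mem_eq_of_isLUB (T := T) hlub
  · have hconst : ∀ m ∈ jointNumericalRange T, M ≤ f m := by
      intro m hm
      obtain ⟨t, ht, hmem⟩ := exists_pos_lineMap_neg_mem (hopen hp) (subset_affineSpan ℝ _ hm)
      have h1 := hM _ hmem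
      rw [AffineMap.lineMap_apply_module] at h1
      simp only [map_add, map_smul, smul_eq_mul, hpM] at h1
      have : t * (M - f m) ≤ 0 := by linarith
      by_contra! h
      nlinarith
    obtain ⟨e, he⟩ := jointEssentialNumericalRange_nonempty hH T
    have h1 : M ≤ f e := closure_minimal (fun m hm => hconst m hm)
      (isClosed_le continuous_const f.continuous) (jointEssentialNumericalRange_subset_closure T he)
    linarith [hfc e he, hM l hl]
  · linarith [hfc p hp, hM l hl]

/-- A functional supporting `W_e` at a relative boundary point `l` of `W` would be constant on `W`,
hence on `W_e`, although it is strictly below `f l` on the relative interior. -/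
theorem jointNumericalRange_subset_intrinsicInterior_of_subset_constantDiagonals
    (hH : ¬ FiniteDimensional ℂ H) (h : jointNumericalRange T ⊆ constantDiagonals T) :
    jointNumericalRange T ⊆ intrinsicInterior ℝ (jointEssentialNumericalRange T) := by
  intro l hl
  by_contra hlC
  have hconv := convex_jointEssentialNumericalRange T
  have hne := Set.Nonempty.intrinsicInterior hconv (jointEssentialNumericalRange_nonempty hH T)
  have hcl := hconv.subset_closure_intrinsicInterior
  have hlE := constantDiagonals_subset_jointEssentialNumericalRange T (h hl)
  obtain ⟨f, hf⟩ :=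
    hconv.convex_intrinsicInterior.exists_lt_of_notMem_of_subset_intrinsicInterior hne
      (intrinsicInterior_subset_intrinsicInterior_self _)
      (closure_subset_affineSpan _ (hcl hlE)) hlC
  have hle : ∀ m ∈ jointNumericalRange T, f m ≤ f l := fun m hm =>
    closure_minimal (fun c hc => (hf c hc).le) (isClosed_le f.continuous continuous_const)
      (hcl (constantDiagonals_subset_jointEssentialNumericalRange T (h hm)))
  have heq := eq_of_mem_constantDiagonals_of_forall_le (h hl) hle
  obtain ⟨c, hc⟩ := hne
  have hc' : f l ≤ f c := closure_minimal (fun m hm => (heq m hm).ge)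
    (isClosed_le continuous_const f.continuous)
    (jointEssentialNumericalRange_subset_closure T (intrinsicInterior_subset hc))
  linarith [hf c hc]

end Diagonals

theorem mainTheorem2 {H : Type*} [NormedAddCommGroup H] [InnerProductSpace ℂ H] [CompleteSpace H]
    [TopologicalSpace.SeparableSpace H] (hH : ¬ FiniteDimensional ℂ H)
    (n : ℕ) (T : Fin n → H →L[ℂ] H) :
    List.TFAE [
      constantDiagonals T = jointNumericalRange T,
      jointNumericalRange T = intrinsicInterior ℝ (jointEssentialNumericalRange T),
      Convex ℝ (jointNumericalRange T) ∧ IsRelativelyOpen (jointNumericalRange T)] := by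
  have hconv := convex_jointEssentialNumericalRange T
  tfae_have 1 → 2 := by
    intro h
    have hWE : jointNumericalRange T ⊆ jointEssentialNumericalRange T :=
      h ▸ constantDiagonals_subset_jointEssentialNumericalRange T
    refine (jointNumericalRange_subset_intrinsicInterior_of_subset_constantDiagonals hH
      h.ge).antisymm (fun w hw => h.le ?_)
    exact intrinsicInterior_jointEssentialNumericalRange_subset_constantDiagonals hH
      (hWE.trans (subset_affineSpan ℝ _)) hw
  tfae_have 2 → 1 := by
    intro h
    refine (constantDiagonals_subset_jointNumericalRange T).antisymm (h.le.trans ?_)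
    exact intrinsicInterior_jointEssentialNumericalRange_subset_constantDiagonals hH
      ((h.le.trans intrinsicInterior_subset).trans (subset_affineSpan ℝ _))
  tfae_have 2 → 3 := by
    intro h
    refine ⟨h ▸ hconv.convex_intrinsicInterior, ?_, isOpen_preimage_affineSpan_iff.2 ?_⟩
    · rw [h]
      exact Set.Nonempty.intrinsicInterior hconv (jointEssentialNumericalRange_nonempty hH T)
    · rw [h]
      exact intrinsicInterior_subset_intrinsicInterior_self _
  tfae_have 3 → 2 := by
    rintro ⟨hW, hne, hopen⟩
    have hopen := isOpen_preimage_affineSpan_iff.1 hopen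
    -- `W_e` is closed and lies between `W` and its closure.
    have hE : jointEssentialNumericalRange T = closure (jointNumericalRange T) :=
      (jointEssentialNumericalRange_subset_closure T).antisymm
        (closure_minimal (jointNumericalRange_subset_jointEssentialNumericalRange hH hopen)
          (isClosed_jointEssentialNumericalRange T))
    rw [hE, hW.intrinsicInterior_closure_eq_self hne hopen]
  tfae_finish
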